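/- All graphs are mixed graphs on one finite vertex set $V$: they have directed edges $X\to Y$ and bi-directed edges $X\leftrightarrow Y$ (with $X\neq Y$), and both kinds may join the same two vertices. d-separation is defined through paths (without repeated vertices): a path is open given $C$ if every collider on it is an ancestor of a member of $C$ and no other interior vertex is in $C$ (every vertex is an ancestor of itself). Two graphs are Markov equivalent if they entail the same d-separations. * A MAG is a mixed graph without directed cycles and without almost directed cycles (a directed path from $X$ to $Y$ together with $X\leftrightarrow Y$), in which any two distinct non-adjacent vertices are d-separated by some set. A loyal equivalent graph (LEG) of a MAG $M$ is a MAG $L$, Markov equivalent to $M$, that has every directed edge of $M$ and each of whose bi-directed edges occurs in every MAG Markov equivalent to $L$. An LEG is an LEG of some MAG. * A causal diagram is a mixed graph without directed cycles. It is *compatible* with an LEG $L$ if it has the same d-separations and the same ancestral relations as $L$ and has every directed edge of $L$. * A causal diagram is *maximally bi-directed* (MBD) if no further bi-directed edge can be added to it without breaking a d-separation. * Let $G$ be a mixed graph with the directed edges of $L$ and possibly more bi-directed edges than $L$. A directed edge $X\to Y$ of $G$ without $X\leftrightarrow Y$ in $G$ is *invisible* in $G$ if some causal diagram compatible with $L$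 contains all edges of $G$ and the edge $X\leftrightarrow Y$. **Procedure** (input: an LEG $L$). For every invisible edge $X\to Y$ of $L$ such that $X$ has no parent or spouse (other than $Y$) that is not adjacent to $Y$, create the diagram obtained from $L$ by adding $X\leftrightarrow Y$; if $L$ has no invisible edge, take $L$ itself as the only diagram. Put those of these diagrams that have invisible edges in a list $S$ and the others in a list $S'$. While $S$ is not empty, do for every $G$ in $S$: create the diagrams $G_1,\dots,G_k$, each obtained from $G$ by adding a bi-directed edge over one of the $k$ invisible edges of $G$; append those without invisible edges to $S'$, append those with invisible edges to $S$, and remove $G$ from $S$. Return $S'$. **Proposition.** For every LEG $L$ on a finite vertex set the procedure terminates, and the diagrams in the list it returns are exactly the maximally bi-directed causal diagrams compatible with $L$. -/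

import Mathlib

/-- A mixed graph on the vertex set `V`: directed edges `X → Y` (`dir X Y`) and bi-directed edges
`X ↔ Y` (`bi X Y`). Both kinds of edges may be present between the same two vertices. -/
@[ext]
structure MixedGraph (V : Type*) where
  dir : V → V → Prop
  bi : V → V → Prop
  bi_symm : ∀ X Y, bi X Y → bi Y X
  bi_irrefl : ∀ X, ¬ bi X X

/-- The ways in which an edge can be traversed from `u` to `v`:
`fwd` is `u → v`, `bwd` is `u ← v`, `bidir` is `u ↔ v`. -/
inductive EdgeKind where
  | fwd
  | bwd
  | bidir

namespace EdgeKind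

/-- The edge has an arrowhead at the vertex where its traversal starts. -/
def HeadAtSource : EdgeKind → Prop
  | fwd => False
  | bwd => True
  | bidir => True

/-- The edge has an arrowhead at the vertex where its traversal ends. -/
def HeadAtTarget : EdgeKind → Prop
  | fwd => True
  | bwd => False
  | bidir => True

end EdgeKind

namespace MixedGraph

variable {V : Type*}

def HasEdge (G : MixedGraph V) : EdgeKind → V → V → Prop
  | .fwd, u, v => G.dir u v
  | .bwd, u, v => G.dir v u
  | .bidir, u, v => G.bi u v

def Adjacent (G : MixedGraph V) (X Y : V) : Prop :=
  G.dir X Y ∨ G.dir Y X ∨ G.bi X Y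

/-- `X` is an ancestor of `Y`; every vertex is an ancestor of itself. -/
def IsAncestor (G : MixedGraph V) (X Y : V) : Prop :=
  Relation.ReflTransGen G.dir X Y

/-- No directed cycle. -/
def DirAcyclic (G : MixedGraph V) : Prop :=
  ∀ X, ¬ Relation.TransGen G.dir X X

/-- Edge-wise inclusion: every edge of `G` is an edge of `H`. -/
def Contains (H G : MixedGraph V) : Prop :=
  (∀ X Y, G.dir X Y → H.dir X Y) ∧ (∀ X Y, G.bi X Y → H.bi X Y)

/-- The graph `G` with the bi-directed edge `X ↔ Y` added. -/
def addBi (G : MixedGraph V) (X Y : V) : MixedGraph V where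
  dir := G.dir
  bi u v := G.bi u v ∨ (u ≠ v ∧ s(u, v) = s(X, Y))
  bi_symm u v h := by
    rcases h with h | ⟨hne, h⟩
    · exact Or.inl (G.bi_symm u v h)
    · exact Or.inr ⟨hne.symm, by rw [Sym2.eq_swap]; exact h⟩
  bi_irrefl u h := by
    rcases h with h | ⟨hne, _⟩
    · exact G.bi_irrefl u h
    · exact hne rfl

/-! ### d-separation -/

/-- Edge sequences in a mixed graph. -/
inductive Walk (G : MixedGraph V) : V → V → Type _ where
  | nil (u : V) : Walk G u u
  | cons {u v w : V} (k : EdgeKind) (h : G.HasEdge k u v) (p : Walk G v w) : Walk G u w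

namespace Walk

variable {G : MixedGraph V}

def support : {u v : V} → Walk G u v → List V
  | _, _, nil u => [u]
  | u, _, cons _ _ p => u :: p.support

/-- The passage through the vertex `v` along an edge of kind `k` (arriving) and an edge of
kind `k'` (leaving) is open given `C`: a collider has to be an ancestor of a member of `C`,
a non-collider has to be outside `C`. -/
def OpenAt (G : MixedGraph V) (C : Set V) (k : EdgeKind) (v : V) (k' : EdgeKind) : Prop :=
  (k.HeadAtTarget ∧ k'.HeadAtSource → ∃ c ∈ C, G.IsAncestor v c) ∧
    (¬ (k.HeadAtTarget ∧ k'.HeadAtSource) → v ∉ C)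

/-- All the passages along the walk are open, when its first vertex is reached
through an edge of kind `k`. -/
def OpenAfter (C : Set V) : {u v : V} → EdgeKind → Walk G u v → Prop
  | _, _, _, nil _ => True
  | u, _, k, cons k' _ p => OpenAt G C k u k' ∧ OpenAfter C k' p

/-- All the passages through interior vertices of the walk are open given `C`. -/
def IsOpen (C : Set V) : {u v : V} → Walk G u v → Prop
  | _, _, nil _ => True
  | _, _, cons k _ p => OpenAfter C k p

end Walk

/-- There is a path (no repeated vertices) between `a` and `b` that is open given `C`. -/
def DConnected (G : MixedGraph V) (C : Set V) (a b : V) : Prop :=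
  ∃ p : Walk G a b, p.support.Nodup ∧ p.IsOpen C

/-- `A` and `B` are d-separated by `C`; for MAGs this is called m-separation. -/
def DSep (G : MixedGraph V) (A B C : Set V) : Prop :=
  ∀ a ∈ A, ∀ b ∈ B, ¬ G.DConnected C a b

/-- The two graphs entail the same d-separations. -/
def MarkovEquiv (G H : MixedGraph V) : Prop :=
  ∀ A B C : Set V, Disjoint A B → Disjoint A C → Disjoint B C → (G.DSep A B C ↔ H.DSep A B C)

/-! ### Maximal ancestral graphs and loyal equivalent graphs -/

/-- No directed cycle, and no almost directed cycle. -/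
def IsAncestral (G : MixedGraph V) : Prop :=
  G.DirAcyclic ∧ ∀ X Y, G.bi X Y → ¬ G.IsAncestor X Y

/-- Any two distinct non-adjacent vertices are d-separated by some set. -/
def IsMaximal (G : MixedGraph V) : Prop :=
  ∀ X Y, X ≠ Y → ¬ G.Adjacent X Y → ∃ Z : Set V, X ∉ Z ∧ Y ∉ Z ∧ G.DSep {X} {Y} Z

def IsMAG (G : MixedGraph V) : Prop :=
  G.IsAncestral ∧ G.IsMaximal

/-- `L` is a loyal equivalent graph of the MAG `G`: a Markov equivalent MAG whose bi-directed
edges are all invariant (present in every Markov equivalent MAG) and which has all the directed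
edges of `G`. -/
def IsLEGOf (L G : MixedGraph V) : Prop :=
  L.IsMAG ∧ L.MarkovEquiv G ∧
    (∀ X Y, L.bi X Y → ∀ H : MixedGraph V, H.IsMAG → H.MarkovEquiv L → H.bi X Y) ∧
    (∀ X Y, G.dir X Y → L.dir X Y)

def IsLEG (L : MixedGraph V) : Prop :=
  ∃ G : MixedGraph V, G.IsMAG ∧ L.IsLEGOf G

/-! ### Causal diagrams -/

/-- A causal diagram (of a recursive structural causal model): bi-directed edges stand for
unobserved confounders, and there is no directed cycle. -/
def IsCausalDiagram (G : MixedGraph V) : Prop :=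
  G.DirAcyclic

/-- The causal diagram `G` is represented by the MAG `L`:
same d-separations, same ancestral relations. -/
def IsRepresentedBy (G L : MixedGraph V) : Prop :=
  G.IsCausalDiagram ∧ G.MarkovEquiv L ∧ ∀ X Y, G.IsAncestor X Y ↔ L.IsAncestor X Y

/-- The causal diagram `G` is represented by `L` and has all the directed edges of `L`. -/
def IsCompatibleWith (G L : MixedGraph V) : Prop :=
  G.IsRepresentedBy L ∧ ∀ X Y, L.dir X Y → G.dir X Y

/-- Maximally bi-directed: adding any further bi-directed edge breaks a d-separation. -/
def IsMBD (G : MixedGraph V) : Prop :=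
  ∀ X Y, X ≠ Y → ¬ G.bi X Y → ¬ (G.addBi X Y).MarkovEquiv G

/-! ### The branching procedure -/

/-- The directed edge `X → Y` of `G` (a diagram built on the graph `L`) is invisible: `G` does not
have `X ↔ Y` yet, and unobserved confounding between `X` and `Y` cannot be ruled out, that is, some
causal diagram compatible with `L` has all the edges of `G` and also `X ↔ Y`. -/
def IsInvisible (L G : MixedGraph V) (X Y : V) : Prop :=
  G.dir X Y ∧ ¬ G.bi X Y ∧ ∃ H : MixedGraph V, H.IsCompatibleWith L ∧ H.Contains G ∧ H.bi X Y

def HasInvisible (L G : MixedGraph V) : Prop :=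
  ∃ X Y, IsInvisible L G X Y

/-- Every parent or spouse of `X` (other than `Y`) is adjacent to `Y`. -/
def ParentsSpousesAdjacent (G : MixedGraph V) (X Y : V) : Prop :=
  ∀ Z, Z ≠ Y → (G.dir Z X ∨ G.bi Z X) → G.Adjacent Z Y

section Algorithm

variable [Fintype V]

/-- A list of the invisible edges of `G`. -/
noncomputable def invisibleEdges (L G : MixedGraph V) : List (V × V) :=
  open Classical in
  (Finset.univ.filter fun e : V × V => IsInvisible L G e.1 e.2).toList

/-- The diagrams `G₁, …, G_k` obtained from `G` by adding a bi-directed edge over one of its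
`k` invisible edges. -/
noncomputable def children (L G : MixedGraph V) : List (MixedGraph V) :=
  (invisibleEdges L G).map fun e => G.addBi e.1 e.2

/-- The diagrams of a list in which invisible edges exist. -/
noncomputable def unfinished (L : MixedGraph V) (l : List (MixedGraph V)) : List (MixedGraph V) :=
  open Classical in
  l.filter fun G => decide (HasInvisible L G)

/-- The diagrams of a list in which invisible edges do not exist. -/
noncomputable def finished (L : MixedGraph V) (l : List (MixedGraph V)) : List (MixedGraph V) :=
  open Classical in
  l.filter fun G => decide (¬ HasInvisible L G)

/-- The diagrams from which the procedure starts: one for every invisible edge `X → Y` of `L` such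
that `X` has no parent or spouse that is not adjacent to `Y`, obtained by adding `X ↔ Y` to `L`;
if `L` has no invisible edge at all, then `L` itself. -/
noncomputable def initialDiagrams (L : MixedGraph V) : List (MixedGraph V) :=
  open Classical in
  if HasInvisible L L then
    ((invisibleEdges L L).filter fun e => decide (L.ParentsSpousesAdjacent e.1 e.2)).map
      fun e => L.addBi e.1 e.2
  else [L]

/-- The initial state `(S, S')` of the procedure: `S` is the list of diagrams that still have to be
processed, `S'` is the list of diagrams to be returned. -/
noncomputable def initialState (L : MixedGraph V) : List (MixedGraph V) × List (MixedGraph V) :=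
  (unfinished L (initialDiagrams L), finished L (initialDiagrams L))

/-- One pass of the while loop: every diagram in `S` is replaced by those of its children which have
invisible edges; the children without invisible edges are appended to `S'`. -/
noncomputable def pass (L : MixedGraph V) (s : List (MixedGraph V) × List (MixedGraph V)) :
    List (MixedGraph V) × List (MixedGraph V) :=
  (s.1.flatMap fun G => unfinished L (children L G),
    s.2 ++ s.1.flatMap fun G => finished L (children L G))

/-- The procedure terminates on the input `L` (the list `S` becomes empty after finitely many
passes) and returns the list `out`. -/
def Returns (L : MixedGraph V) (out : List (MixedGraph V)) : Prop :=
  ∃ n : ℕ, (pass L)^[n] (initialState L) = ([], out)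

end Algorithm

end MixedGraph

/-!
A diagram `H` compatible with a MAG `L` has exactly the directed edges of `L`: its adjacencies are
adjacencies of `L`, and the ancestral relations fix the orientation. Hence the bi-directed edges of
`H` that `L` lacks lie over directed edges of `L`, and they are invisible in every diagram between
`L` and `H`. Since d-connections only grow when edges are added, every diagram between `L` and a
compatible one is compatible too; so the procedure stays among compatible diagrams, climbs to every
compatible diagram that contains `L` and has no invisible edge, and finds only those. The condition
on parents and spouses in its first step excludes nothing: a parent or spouse `Z` of `X` that is not
adjacent to `Y` would make `Z, X, Y` an unshielded collider after adding `X ↔ Y`, and a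
non-collider before.

It remains to see that a maximally bi-directed compatible `H` contains `L`. If `X ↔ Y` is in `L`,
then `X` and `Y` are d-connected in `H` given their other ancestors, and an open path can only be an
inducing path: all its edges are bi-directed and all its vertices are ancestors of `X` or `Y`.
Whatever the conditioning set, such a path yields an open trail with arrowheads at `X` and `Y`, so
adding `X ↔ Y` to `H` breaks no d-separation, and `H` must already have that edge.
-/

namespace EdgeKind

/-- The kind of the same edge traversed in the opposite direction. -/
def reverse : EdgeKind → EdgeKind
  | fwd => bwd
  | bwd => fwd
  | bidir => bidir

theorem headAtSource_reverse (k : EdgeKind) : k.reverse.HeadAtSource ↔ k.HeadAtTarget := by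
  cases k <;> exact Iff.rfl

theorem headAtTarget_reverse (k : EdgeKind) : k.reverse.HeadAtTarget ↔ k.HeadAtSource := by
  cases k <;> exact Iff.rfl

end EdgeKind

namespace MixedGraph

variable {V : Type*} {G H K L : MixedGraph V} {C S T : Set V} {u v w X Y Z : V}
  {j k l k' l' : EdgeKind}

/-! ### Inclusion and ancestors -/

theorem Contains.refl (G : MixedGraph V) : G.Contains G :=
  ⟨fun _ _ h => h, fun _ _ h => h⟩

theorem Contains.trans (h : K.Contains H) (h' : H.Contains G) : K.Contains G :=
  ⟨fun X Y e => h.1 X Y (h'.1 X Y e), fun X Y e => h.2 X Y (h'.2 X Y e)⟩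

theorem Contains.antisymm (h : H.Contains G) (h' : G.Contains H) : G = H := by
  ext X Y
  · exact ⟨h.1 X Y, h'.1 X Y⟩
  · exact ⟨h.2 X Y, h'.2 X Y⟩

theorem addBi_contains (G : MixedGraph V) (X Y : V) : (G.addBi X Y).Contains G :=
  ⟨fun _ _ h => h, fun _ _ h => .inl h⟩

theorem addBi_bi_self (h : X ≠ Y) : (G.addBi X Y).bi X Y :=
  .inr ⟨h, rfl⟩

theorem Contains.addBi (h : H.Contains G) (hXY : H.bi X Y) : H.Contains (G.addBi X Y) := by
  refine ⟨h.1, fun u v huv => ?_⟩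
  rcases huv with huv | ⟨-, huv⟩
  · exact h.2 u v huv
  · rcases Sym2.eq_iff.1 huv with ⟨rfl, rfl⟩ | ⟨rfl, rfl⟩
    · exact hXY
    · exact H.bi_symm _ _ hXY

theorem HasEdge.mono (h : H.Contains G) (e : G.HasEdge k u v) : H.HasEdge k u v := by
  cases k with
  | fwd => exact h.1 u v e
  | bwd => exact h.1 v u e
  | bidir => exact h.2 u v e

theorem HasEdge.reverse (e : G.HasEdge k u v) : G.HasEdge k.reverse v u := by
  cases k with
  | fwd => exact e
  | bwd => exact e
  | bidir => exact G.bi_symm u v e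

theorem bi_ne (h : G.bi X Y) : X ≠ Y := by
  rintro rfl
  exact G.bi_irrefl X h

theorem IsAncestor.mono (h : H.Contains G) (ha : G.IsAncestor u v) : H.IsAncestor u v :=
  Relation.ReflTransGen.mono h.1 _ _ ha

theorem DirAcyclic.anti (h : H.Contains G) (hH : H.DirAcyclic) : G.DirAcyclic :=
  fun X hX => hH X (Relation.TransGen.mono h.1 _ _ hX)

theorem DirAcyclic.not_isAncestor (hG : G.DirAcyclic) (h : G.dir u v) : ¬ G.IsAncestor v u :=
  fun ha => hG u (Relation.TransGen.head' h ha)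

/-- The set of all ancestors of members of `S`, in particular of all members of `S`. The collider
condition of d-separation given `C` is membership in `G.ancestors C`. -/
def ancestors (G : MixedGraph V) (S : Set V) : Set V :=
  {v | ∃ s ∈ S, G.IsAncestor v s}

theorem subset_ancestors : S ⊆ G.ancestors S :=
  fun v hv => ⟨v, hv, .refl⟩

theorem IsAncestor.mem_ancestors (h : G.IsAncestor u v) (hv : v ∈ G.ancestors S) :
    u ∈ G.ancestors S := by
  obtain ⟨s, hs, hvs⟩ := hv
  exact ⟨s, hs, h.trans hvs⟩

theorem ancestors_subset (h : S ⊆ G.ancestors T) : G.ancestors S ⊆ G.ancestors T := by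
  rintro v ⟨s, hs, hvs⟩
  exact hvs.mem_ancestors (h hs)

theorem mem_ancestors_pair : v ∈ G.ancestors {X, Y} ↔ G.IsAncestor v X ∨ G.IsAncestor v Y := by
  simp [ancestors]

theorem ancestors_mono (h : H.Contains G) : G.ancestors S ⊆ H.ancestors S := by
  rintro v ⟨s, hs, hvs⟩
  exact ⟨s, hs, hvs.mono h⟩

/-! ### Open walks and paths -/

namespace Walk

theorem target_mem_support (p : Walk G u v) : v ∈ p.support := by
  induction p with
  | nil u => exact List.mem_singleton_self u
  | cons _ _ _ ih => exact List.mem_cons_of_mem _ ih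

theorem openAt_of_collider (hk : k.HeadAtTarget) (hl : l.HeadAtSource) (hv : v ∈ G.ancestors C) :
    OpenAt G C k v l :=
  ⟨fun _ => hv, fun h => absurd ⟨hk, hl⟩ h⟩

theorem openAt_of_not_collider (h : ¬ (k.HeadAtTarget ∧ l.HeadAtSource)) (hv : v ∉ C) :
    OpenAt G C k v l :=
  ⟨fun h' => absurd h' h, fun _ => hv⟩

theorem OpenAt.congr (h : OpenAt G C k v l) (hGH : G.ancestors C ⊆ H.ancestors C)
    (hk : k'.HeadAtTarget ↔ k.HeadAtTarget) (hl : l'.HeadAtSource ↔ l.HeadAtSource) :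
    OpenAt H C k' v l' := by
  unfold OpenAt
  rw [hk, hl]
  exact ⟨fun hc => hGH (h.1 hc), h.2⟩

theorem OpenAt.reverse (h : OpenAt G C k v l) : OpenAt G C l.reverse v k.reverse := by
  unfold OpenAt
  rw [EdgeKind.headAtTarget_reverse, EdgeKind.headAtSource_reverse, and_comm (a := l.HeadAtSource)]
  exact h

/-- A detour that leaves `v` by an edge of kind `l` and comes back by an edge of kind `j` can be cut
out. The last hypothesis is only at stake when the detour starts with `v → ⋯`: then it either
reaches a collider, which is a descendant of `v`, or it comes back as `⋯ → v`. -/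
theorem OpenAt.shortcut (h : OpenAt G C k v l) (h' : OpenAt G C j v l')
    (hdetour : ¬ l.HeadAtSource → v ∈ G.ancestors C ∨ j.HeadAtTarget) : OpenAt G C k v l' := by
  refine ⟨fun ⟨hk, hl'⟩ => ?_, fun hn hC => ?_⟩
  · by_cases hl : l.HeadAtSource
    · exact h.1 ⟨hk, hl⟩
    · exact (hdetour hl).elim id fun hj => h'.1 ⟨hj, hl'⟩
  · by_cases hk : k.HeadAtTarget
    · exact h'.2 (fun hc => hn ⟨hk, hc.2⟩) hC
    · exact h.2 (fun hc => hk hc.1) hC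

theorem OpenAfter.isOpen {p : Walk G u w} (hp : p.OpenAfter C k) : p.IsOpen C := by
  cases p with
  | nil => trivial
  | cons => exact hp.2

theorem OpenAfter.exists_suffix {p : Walk G u w} (hp : p.OpenAfter C k) (hv : v ∈ p.support) :
    ∃ (q : Walk G v w) (j : EdgeKind), q.OpenAfter C j ∧ q.support <:+ p.support ∧
      (k.HeadAtTarget → u ∈ G.ancestors C ∨ j.HeadAtTarget) := by
  induction p generalizing k with
  | nil u =>
    obtain rfl := List.mem_singleton.1 hv
    exact ⟨.nil v, k, trivial, List.suffix_rfl, .inr⟩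
  | cons k' e p ih =>
    rcases List.mem_cons.1 hv with rfl | hv
    · exact ⟨.cons k' e p, k, hp, List.suffix_rfl, .inr⟩
    obtain ⟨q, j, hq, hsuffix, hj⟩ := ih hp.2 hv
    refine ⟨q, j, hq, hsuffix.trans (List.suffix_cons _ _), fun hk => ?_⟩
    cases k' with
    | fwd => exact (hj trivial).imp_left (IsAncestor.mem_ancestors (.single e))
    | bwd => exact .inl (hp.1.1 ⟨hk, trivial⟩)
    | bidir => exact .inl (hp.1.1 ⟨hk, trivial⟩)

theorem OpenAfter.exists_path {p : Walk G u w} (hp : p.OpenAfter C k) :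
    ∃ q : Walk G u w, q.support.Nodup ∧ q.OpenAfter C k := by
  induction p generalizing k with
  | nil u => exact ⟨.nil u, List.nodup_singleton u, trivial⟩
  | @cons u _ _ k' e p ih =>
    obtain ⟨q, hnodup, hq⟩ := ih hp.2
    by_cases hu : u ∈ q.support
    · obtain ⟨r, j, hr, hsuffix, hj⟩ := hq.exists_suffix hu
      refine ⟨r, hnodup.sublist hsuffix.sublist, ?_⟩
      cases r with
      | nil => trivial
      | cons =>
        refine ⟨hp.1.shortcut hr.1 fun hk' => ?_, hr.2⟩
        cases k' with
        | fwd => exact (hj trivial).imp_left (IsAncestor.mem_ancestors (.single e))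
        | bwd => exact absurd trivial hk'
        | bidir => exact absurd trivial hk'
    · exact ⟨.cons k' e q, List.nodup_cons.2 ⟨hu, hnodup⟩, hp.1, hq⟩

theorem IsOpen.dConnected {p : Walk G u w} (hp : p.IsOpen C) : G.DConnected C u w := by
  cases p with
  | nil => exact ⟨.nil u, List.nodup_singleton u, trivial⟩
  | cons k e p =>
    obtain ⟨q, hnodup, hq⟩ := OpenAfter.exists_path hp
    by_cases hu : u ∈ q.support
    · obtain ⟨r, _, hr, hsuffix, _⟩ := hq.exists_suffix hu
      exact ⟨r, hnodup.sublist hsuffix.sublist, hr.isOpen⟩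
    · exact ⟨.cons k e q, List.nodup_cons.2 ⟨hu, hnodup⟩, hq⟩

end Walk

/-! ### Open trails -/

/-- `G.Trail C k u v l`: some nonempty walk from `u` to `v`, with first edge of kind `k` and last
edge of kind `l`, is open given `C`. Vertices may be repeated, so that trails can be concatenated;
only the arrowheads at the two ends matter for that. -/
inductive Trail (G : MixedGraph V) (C : Set V) : EdgeKind → V → V → EdgeKind → Prop
  | single {k : EdgeKind} {u v : V} (e : G.HasEdge k u v) : Trail G C k u v k
  | cons {k k' l : EdgeKind} {u v w : V} (e : G.HasEdge k u v) (ho : Walk.OpenAt G C k v k')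
      (t : Trail G C k' v w l) : Trail G C k u w l

theorem Trail.append (s : G.Trail C k u v l) (ho : Walk.OpenAt G C l v k')
    (t : G.Trail C k' v w l') : G.Trail C k u w l' := by
  induction s with
  | single e => exact .cons e ho t
  | cons e ho' _ ih => exact .cons e ho' (ih ho t)

theorem Trail.reverse (t : G.Trail C k u v l) : G.Trail C l.reverse v u k.reverse := by
  induction t with
  | single e => exact .single e.reverse
  | cons e ho _ ih => exact ih.append ho.reverse (.single e.reverse)

theorem Trail.exists_openAfter (t : G.Trail C k u w l) :
    ∃ (v : V) (_ : G.HasEdge k u v) (p : Walk G v w), p.OpenAfter C k := by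
  induction t with
  | single e => exact ⟨_, e, .nil _, trivial⟩
  | cons e ho _ ih =>
    obtain ⟨_, e', p, hp⟩ := ih
    exact ⟨_, e, .cons _ e' p, ho, hp⟩

theorem Trail.dConnected (t : G.Trail C k u v l) : G.DConnected C u v := by
  obtain ⟨_, e, p, hp⟩ := t.exists_openAfter
  exact Walk.IsOpen.dConnected (p := .cons k e p) hp

theorem Walk.OpenAfter.exists_trail {p : Walk G v w} (e : G.HasEdge k u v)
    (hp : p.OpenAfter C k) : ∃ l, G.Trail C k u w l := by
  induction p generalizing u k with
  | nil => exact ⟨k, .single e⟩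
  | cons k' e' p ih =>
    obtain ⟨l, t⟩ := ih e' hp.2
    exact ⟨l, .cons e hp.1 t⟩

theorem dConnected_iff : G.DConnected C u v ↔ u = v ∨ ∃ k l, G.Trail C k u v l := by
  constructor
  · rintro ⟨p, -, hp⟩
    cases p with
    | nil => exact .inl rfl
    | cons k e p => exact .inr ⟨k, Walk.OpenAfter.exists_trail e hp⟩
  · rintro (rfl | ⟨k, l, t⟩)
    · exact Walk.IsOpen.dConnected (p := .nil u) trivial
    · exact t.dConnected

/-- Some trail from `u` to `v` that is open given `C` has arrowheads at its two ends exactly where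
an edge of kind `k` from `u` to `v` has them, so that it can replace such an edge in an open trail.
-/
def HasDetour (G : MixedGraph V) (C : Set V) (k : EdgeKind) (u v : V) : Prop :=
  ∃ k' l', G.Trail C k' u v l' ∧ (k'.HeadAtSource ↔ k.HeadAtSource) ∧
    (l'.HeadAtTarget ↔ k.HeadAtTarget)

theorem HasEdge.hasDetour (e : G.HasEdge k u v) : G.HasDetour C k u v :=
  ⟨k, k, .single e, Iff.rfl, Iff.rfl⟩

theorem Trail.hasDetour_bidir (t : G.Trail C k u v l) (hk : k.HeadAtSource)
    (hl : l.HeadAtTarget) : G.HasDetour C .bidir u v :=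
  ⟨k, l, t, iff_of_true hk trivial, iff_of_true hl trivial⟩

theorem HasDetour.reverse (h : G.HasDetour C k u v) : G.HasDetour C k.reverse v u := by
  obtain ⟨k', l', t, hk, hl⟩ := h
  refine ⟨_, _, t.reverse, ?_, ?_⟩
  · rwa [EdgeKind.headAtSource_reverse, EdgeKind.headAtSource_reverse]
  · rwa [EdgeKind.headAtTarget_reverse, EdgeKind.headAtTarget_reverse]

theorem Trail.exists_trail_of_hasDetour (hGH : G.ancestors C ⊆ H.ancestors C)
    (hedge : ∀ {k u v}, G.HasEdge k u v → H.HasDetour C k u v) (t : G.Trail C k u v l) :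
    ∃ k' l', H.Trail C k' u v l' ∧ (k'.HeadAtSource ↔ k.HeadAtSource) := by
  induction t with
  | single e =>
    obtain ⟨k', l', t, hk, -⟩ := hedge e
    exact ⟨k', l', t, hk⟩
  | cons e ho _ ih =>
    obtain ⟨k₁, l₁, t₁, hk₁, hl₁⟩ := hedge e
    obtain ⟨k₂, l₂, t₂, hk₂⟩ := ih
    exact ⟨k₁, l₂, t₁.append (ho.congr hGH hl₁ hk₂) t₂, hk₁⟩

theorem DConnected.of_hasDetour (hGH : G.ancestors C ⊆ H.ancestors C)
    (hedge : ∀ {k u v}, G.HasEdge k u v → H.HasDetour C k u v) (h : G.DConnected C u v) :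
    H.DConnected C u v := by
  rcases dConnected_iff.1 h with huv | ⟨k, l, t⟩
  · exact dConnected_iff.2 (.inl huv)
  · obtain ⟨_, _, t', -⟩ := t.exists_trail_of_hasDetour hGH hedge
    exact t'.dConnected

theorem DConnected.mono (h : H.Contains G) (hc : G.DConnected C u v) : H.DConnected C u v :=
  hc.of_hasDetour (ancestors_mono h) fun e => (e.mono h).hasDetour

/-! ### Markov equivalence -/

theorem DSep.anti {A B : Set V} (h : H.Contains G) (hs : H.DSep A B C) : G.DSep A B C :=
  fun a ha b hb hc => hs a ha b hb (hc.mono h)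

theorem dSep_singleton : G.DSep {X} {Y} C ↔ ¬ G.DConnected C X Y := by
  simp only [DSep, Set.mem_singleton_iff, forall_eq]

theorem MarkovEquiv.refl (G : MixedGraph V) : G.MarkovEquiv G :=
  fun _ _ _ _ _ _ => Iff.rfl

theorem MarkovEquiv.symm (h : G.MarkovEquiv H) : H.MarkovEquiv G :=
  fun A B C hAB hAC hBC => (h A B C hAB hAC hBC).symm

theorem MarkovEquiv.trans (h : G.MarkovEquiv H) (h' : H.MarkovEquiv K) : G.MarkovEquiv K :=
  fun A B C hAB hAC hBC => (h A B C hAB hAC hBC).trans (h' A B C hAB hAC hBC)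

theorem MarkovEquiv.dConnected_iff (h : G.MarkovEquiv H) (hne : X ≠ Y) (hX : X ∉ C)
    (hY : Y ∉ C) : G.DConnected C X Y ↔ H.DConnected C X Y := by
  have hsep := h {X} {Y} C (Set.disjoint_singleton.2 hne) (Set.disjoint_singleton_left.2 hX)
    (Set.disjoint_singleton_left.2 hY)
  rw [dSep_singleton, dSep_singleton] at hsep
  exact not_iff_not.1 hsep

theorem MarkovEquiv.of_contains (h : H.MarkovEquiv L) (hHG : H.Contains G)
    (hGL : G.Contains L) : G.MarkovEquiv L :=
  fun A B C hAB hAC hBC =>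
    ⟨DSep.anti hGL, fun hs => DSep.anti hHG ((h A B C hAB hAC hBC).2 hs)⟩

theorem markovEquiv_addBi (h : ∀ C, G.HasDetour C .bidir X Y) :
    (G.addBi X Y).MarkovEquiv G := by
  refine fun A B C _ _ _ => ⟨DSep.anti (addBi_contains G X Y), fun hs a ha b hb hc => ?_⟩
  have hedge : ∀ {k u v}, (G.addBi X Y).HasEdge k u v → G.HasDetour C k u v := by
    rintro (_ | _ | _) u v e
    · exact HasEdge.hasDetour (k := .fwd) e
    · exact HasEdge.hasDetour (k := .bwd) e
    · rcases e with e | ⟨-, e⟩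
      · exact HasEdge.hasDetour (k := .bidir) e
      · rcases Sym2.eq_iff.1 e with ⟨rfl, rfl⟩ | ⟨rfl, rfl⟩
        · exact h C
        · exact (h C).reverse
  exact hs a ha b hb (hc.of_hasDetour (G := G.addBi X Y) subset_rfl hedge)

theorem Adjacent.dConnected (h : G.Adjacent X Y) (C : Set V) : G.DConnected C X Y := by
  rcases h with e | e | e
  · exact (Trail.single (k := .fwd) e).dConnected
  · exact (Trail.single (k := .bwd) e).dConnected
  · exact (Trail.single (k := .bidir) e).dConnected

theorem IsMaximal.exists_not_dConnected (hL : L.IsMaximal) (hne : X ≠ Y)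
    (h : ¬ L.Adjacent X Y) : ∃ C : Set V, X ∉ C ∧ Y ∉ C ∧ ¬ L.DConnected C X Y := by
  obtain ⟨C, hX, hY, hsep⟩ := hL X Y hne h
  exact ⟨C, hX, hY, dSep_singleton.1 hsep⟩

theorem IsMaximal.adjacent_of_markovEquiv (hL : L.IsMaximal) (h : G.MarkovEquiv L) (hne : X ≠ Y)
    (hG : G.Adjacent X Y) : L.Adjacent X Y := by
  by_contra hn
  obtain ⟨C, hX, hY, hC⟩ := hL.exists_not_dConnected hne hn
  exact hC ((h.dConnected_iff hne hX hY).1 (hG.dConnected C))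

theorem IsMaximal.parentsSpousesAdjacent (hL : L.IsMaximal) (h : H.MarkovEquiv L)
    (hHL : H.Contains L) (hdir : L.dir X Y) (hbi : H.bi X Y) : L.ParentsSpousesAdjacent X Y := by
  intro Z hZY hZX
  by_contra hn
  obtain ⟨C, hZ, hY, hC⟩ := hL.exists_not_dConnected hZY hn
  obtain ⟨k, e, hk⟩ : ∃ k : EdgeKind, L.HasEdge k Z X ∧ k.HeadAtTarget :=
    hZX.elim (fun e => ⟨.fwd, e, trivial⟩) fun e => ⟨.bidir, e, trivial⟩
  have hXC : X ∈ C := by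
    by_contra hX
    exact hC (Trail.cons e (Walk.openAt_of_not_collider And.right hX)
      (.single (k := .fwd) hdir)).dConnected
  have hcollider : H.DConnected C Z Y :=
    (Trail.cons (k' := .bidir) (e.mono hHL)
      (Walk.openAt_of_collider hk trivial (subset_ancestors hXC)) (.single hbi)).dConnected
  exact hC ((h.dConnected_iff hZY hZ hY).1 hcollider)

/-! ### Inducing paths -/

/-- `X` and `Y` are joined by a nonempty sequence of bi-directed edges whose vertices are all
ancestors of `X` or `Y`. Between vertices that are not ancestors of each other these are the
inducing paths of the theory of ancestral graphs. -/
def HasInducingPath (G : MixedGraph V) (X Y : V) : Prop :=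
  Relation.TransGen (fun u v => G.bi u v ∧ v ∈ G.ancestors {X, Y}) X Y

theorem IsAncestor.trail (h : G.IsAncestor u v) (huv : u ≠ v) (hu : u ∉ G.ancestors C) :
    G.Trail C .fwd u v .fwd := by
  induction h using Relation.ReflTransGen.head_induction_on with
  | refl => exact absurd rfl huv
  | @head a c e _ ih =>
    by_cases hcv : c = v
    · subst hcv
      exact .single e
    · have hc : c ∉ G.ancestors C := fun hc => hu (IsAncestor.mem_ancestors (.single e) hc)
      exact .cons e (Walk.openAt_of_not_collider And.right fun h => hc (subset_ancestors h))
        (ih hcv hc)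

/-- `v` is `X`, or is reached from `X` by an open trail with an arrowhead at `X` that stays open
when prolonged by an edge with an arrowhead at `v`: the initial segments of a detour for
`X ↔ Y`. -/
def IsIntoReachable (G : MixedGraph V) (C : Set V) (X v : V) : Prop :=
  v = X ∨ ∃ k l, G.Trail C k X v l ∧ k.HeadAtSource ∧ Walk.OpenAt G C l v .bidir

theorem IsIntoReachable.exists_trail (h : G.IsIntoReachable C X u) (e : G.bi u v) :
    ∃ k, G.Trail C k X v .bidir ∧ k.HeadAtSource := by
  rcases h with rfl | ⟨k, l, t, hk, ho⟩
  · exact ⟨.bidir, .single e, trivial⟩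
  · exact ⟨k, t.append ho (.single e), hk⟩

/-- If `v` is not an ancestor of `C`, so that it would block the trail as a collider, then the trail
is replaced by a directed path `X ⟵ ⋯ ⟵ v`, or completed by a directed path `v ⟶ ⋯ ⟶ Y`; no vertex
of these is in `C`. -/
theorem Trail.isIntoReachable_or_hasDetour (t : G.Trail C k X v .bidir) (hk : k.HeadAtSource)
    (hv : v ∈ G.ancestors {X, Y}) : G.IsIntoReachable C X v ∨ G.HasDetour C .bidir X Y := by
  by_cases hvC : v ∈ G.ancestors C
  · exact .inl (.inr ⟨k, .bidir, t, hk, Walk.openAt_of_collider trivial trivial hvC⟩)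
  have hv' : v ∉ C := fun h => hvC (subset_ancestors h)
  rcases mem_ancestors_pair.1 hv with hvX | hvY
  · left
    by_cases hne : v = X
    · exact .inl hne
    · exact .inr ⟨.bwd, .bwd, (hvX.trail hne hvC).reverse, trivial,
        Walk.openAt_of_not_collider And.left hv'⟩
  · right
    by_cases hne : v = Y
    · subst hne
      exact t.hasDetour_bidir hk trivial
    · exact (t.append (Walk.openAt_of_not_collider And.right hv')
        (hvY.trail hne hvC)).hasDetour_bidir hk trivial

theorem HasInducingPath.hasDetour (h : G.HasInducingPath X Y) (C : Set V) :
    G.HasDetour C .bidir X Y := by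
  obtain ⟨w, hXw, hwY, -⟩ := Relation.TransGen.tail'_iff.1 h
  have hw : G.IsIntoReachable C X w ∨ G.HasDetour C .bidir X Y := by
    clear hwY
    induction hXw with
    | refl => exact .inl (.inl rfl)
    | tail _ hstep ih =>
      rcases ih with hu | hdetour
      · obtain ⟨k, t, hk⟩ := hu.exists_trail hstep.1
        exact t.isIntoReachable_or_hasDetour hk hstep.2
      · exact .inr hdetour
  rcases hw with hw | hdetour
  · obtain ⟨k, t, hk⟩ := hw.exists_trail hwY
    exact t.hasDetour_bidir hk trivial
  · exact hdetour

theorem Walk.OpenAfter.mem_ancestors {p : Walk G u w} (hp : p.OpenAfter C k)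
    (hC : C ⊆ G.ancestors S) (hw : w ∈ G.ancestors S) (hk : k.HeadAtTarget) :
    u ∈ G.ancestors S := by
  induction p generalizing k with
  | nil => exact hw
  | cons k' e p ih =>
    cases k' with
    | fwd => exact IsAncestor.mem_ancestors (.single e) (ih hp.2 hw trivial)
    | bwd => exact ancestors_subset hC (hp.1.1 ⟨hk, trivial⟩)
    | bidir => exact ancestors_subset hC (hp.1.1 ⟨hk, trivial⟩)

theorem Walk.OpenAfter.mem_ancestors_of_hasEdge {p : Walk G v w} (hp : p.OpenAfter C k)
    (hC : C ⊆ G.ancestors S) (hw : w ∈ G.ancestors S) (e : G.HasEdge k u v)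
    (hu : u ∈ G.ancestors S) : v ∈ G.ancestors S := by
  cases k with
  | fwd => exact hp.mem_ancestors hC hw trivial
  | bwd => exact IsAncestor.mem_ancestors (.single e) hu
  | bidir => exact hp.mem_ancestors hC hw trivial

theorem DirAcyclic.notMem_ancestors_pair (hG : G.DirAcyclic) (hYX : ¬ G.IsAncestor Y X)
    (e : G.dir Y v) : v ∉ G.ancestors {X, Y} := by
  rw [mem_ancestors_pair]
  rintro (hvX | hvY)
  · exact hYX (.head e hvX)
  · exact hG.not_isAncestor e hvY

/-- Every vertex of the path is an ancestor of `X` or `Y`, so every vertex other than `Y` belongs to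
the conditioning set and has to be a collider. -/
theorem Walk.OpenAfter.reflTransGen_bi (hG : G.DirAcyclic) (hYX : ¬ G.IsAncestor Y X)
    {p : Walk G u Y} (hp : p.OpenAfter (G.ancestors {X, Y} \ {X, Y}) k)
    (hnodup : p.support.Nodup) (hX : X ∉ p.support) (hu : u ∈ G.ancestors {X, Y}) :
    Relation.ReflTransGen (fun u v => G.bi u v ∧ v ∈ G.ancestors {X, Y}) u Y ∧
      (u ≠ Y → k.HeadAtTarget) := by
  induction p generalizing k with
  | nil => exact ⟨.refl, fun h => absurd rfl h⟩
  | @cons u v Y k' e p ih =>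
    obtain ⟨hup, hnodup'⟩ := List.nodup_cons.1 hnodup
    obtain ⟨hXu, hXp⟩ := not_or.1 (mt List.mem_cons.2 hX)
    have huY : u ≠ Y := fun h => hup (h ▸ p.target_mem_support)
    have hcollider : k.HeadAtTarget ∧ k'.HeadAtSource := by
      by_contra hn
      exact hp.1.2 hn ⟨hu, by simp [Ne.symm hXu, huY]⟩
    have hv : v ∈ G.ancestors {X, Y} :=
      hp.2.mem_ancestors_of_hasEdge Set.sdiff_subset (subset_ancestors (by simp)) e hu
    obtain ⟨hvY, hk'⟩ := ih hYX hp.2 hnodup' hXp hv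
    refine ⟨?_, fun _ => hcollider.1⟩
    cases k' with
    | fwd => exact hcollider.2.elim
    | bwd =>
      by_cases h : v = Y
      · subst h
        exact absurd hu (hG.notMem_ancestors_pair hYX e)
      · exact (hk' h).elim
    | bidir => exact .head ⟨e, hv⟩ hvY

theorem DConnected.hasInducingPath (hG : G.DirAcyclic) (hXY : ¬ G.IsAncestor X Y)
    (hYX : ¬ G.IsAncestor Y X) (h : G.DConnected (G.ancestors {X, Y} \ {X, Y}) X Y) :
    G.HasInducingPath X Y := by
  obtain ⟨p, hnodup, hp⟩ := h
  cases p with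
  | nil => exact absurd .refl hXY
  | @cons _ v _ k e p =>
    obtain ⟨hXp, hnodup'⟩ := List.nodup_cons.1 hnodup
    have hv : v ∈ G.ancestors {X, Y} :=
      Walk.OpenAfter.mem_ancestors_of_hasEdge hp Set.sdiff_subset (subset_ancestors (by simp)) e
        (subset_ancestors (by simp))
    obtain ⟨hvY, hk⟩ := Walk.OpenAfter.reflTransGen_bi hG hYX hp hnodup' hXp hv
    cases k with
    | fwd => exact absurd (Set.pair_comm X Y ▸ hv) (hG.notMem_ancestors_pair hXY e)
    | bwd =>
      by_cases h : v = Y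
      · subst h
        exact absurd (.single e) hYX
      · exact (hk h).elim
    | bidir => exact .head' ⟨e, hv⟩ hvY

/-! ### Compatible diagrams -/

theorem IsCompatibleWith.markovEquiv (h : G.IsCompatibleWith L) : G.MarkovEquiv L :=
  h.1.2.1

theorem IsCompatibleWith.isAncestor_iff (h : G.IsCompatibleWith L) :
    G.IsAncestor X Y ↔ L.IsAncestor X Y :=
  h.1.2.2 X Y

theorem IsCompatibleWith.dirAcyclic (h : G.IsCompatibleWith L) : G.DirAcyclic :=
  h.1.1

theorem DirAcyclic.isCompatibleWith_self (hL : L.DirAcyclic) : L.IsCompatibleWith L :=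
  ⟨⟨hL, .refl L, fun _ _ => Iff.rfl⟩, fun _ _ e => e⟩

theorem IsCompatibleWith.of_contains (h : H.IsCompatibleWith L) (hHG : H.Contains G)
    (hGL : G.Contains L) : G.IsCompatibleWith L :=
  ⟨⟨h.dirAcyclic.anti hHG, h.markovEquiv.of_contains hHG hGL,
    fun _ _ => ⟨fun ha => h.isAncestor_iff.1 (ha.mono hHG), .mono hGL⟩⟩, hGL.1⟩

theorem IsCompatibleWith.addBi (h : G.IsCompatibleWith L)
    (hequiv : (G.addBi X Y).MarkovEquiv G) : (G.addBi X Y).IsCompatibleWith L :=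
  ⟨⟨h.1.1, hequiv.trans h.markovEquiv, h.1.2.2⟩, h.2⟩

theorem IsCompatibleWith.dir_eq (hL : L.IsMAG) (h : H.IsCompatibleWith L) : H.dir = L.dir := by
  funext X Y
  refine propext ⟨fun e => ?_, h.2 X Y⟩
  have hne : X ≠ Y := by
    rintro rfl
    exact h.dirAcyclic X (.single e)
  have hXY : L.IsAncestor X Y := h.isAncestor_iff.1 (.single e)
  rcases hL.2.adjacent_of_markovEquiv h.markovEquiv hne (.inl e) with e' | e' | e'
  · exact e'
  · exact absurd hXY (hL.1.1.not_isAncestor e')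
  · exact absurd hXY (hL.1.2 X Y e')

theorem IsCompatibleWith.contains_of_isMBD (hL : L.IsAncestral) (h : H.IsCompatibleWith L)
    (hmax : H.IsMBD) : H.Contains L := by
  refine ⟨h.2, fun X Y e => by_contra fun hn => ?_⟩
  have hXY : ¬ H.IsAncestor X Y := fun ha => hL.2 X Y e (h.isAncestor_iff.1 ha)
  have hYX : ¬ H.IsAncestor Y X :=
    fun ha => hL.2 Y X (L.bi_symm X Y e) (h.isAncestor_iff.1 ha)
  have hconn : H.DConnected (H.ancestors {X, Y} \ {X, Y}) X Y :=
    (h.markovEquiv.dConnected_iff (bi_ne e) (by simp) (by simp)).2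
      (Adjacent.dConnected (.inr (.inr e)) _)
  exact hmax X Y (bi_ne e) hn
    (markovEquiv_addBi (hconn.hasInducingPath h.dirAcyclic hXY hYX).hasDetour)

/-! ### Invisible edges -/

theorem IsInvisible.ne (h : IsInvisible L G X Y) : X ≠ Y := by
  obtain ⟨-, -, _, -, -, hbi⟩ := h
  exact bi_ne hbi

theorem IsInvisible.addBi_isCompatibleWith (hGL : G.Contains L) (h : IsInvisible L G X Y) :
    (G.addBi X Y).IsCompatibleWith L := by
  obtain ⟨-, -, H, hH, hHG, hbi⟩ := h
  exact hH.of_contains (hHG.addBi hbi) ((addBi_contains G X Y).trans hGL)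

theorem IsInvisible.parentsSpousesAdjacent (hL : L.IsMaximal) (h : IsInvisible L L X Y) :
    L.ParentsSpousesAdjacent X Y := by
  obtain ⟨hdir, -, H, hH, hHL, hbi⟩ := h
  exact hL.parentsSpousesAdjacent hH.markovEquiv hHL hdir hbi

theorem IsCompatibleWith.isInvisible_or_isInvisible (hL : L.IsMaximal) (hH : H.IsCompatibleWith L)
    (hHG : H.Contains G) (hGL : G.Contains L) (hbi : H.bi X Y) (hn : ¬ G.bi X Y) :
    IsInvisible L G X Y ∨ IsInvisible L G Y X := by
  rcases hL.adjacent_of_markovEquiv hH.markovEquiv (bi_ne hbi) (.inr (.inr hbi)) with e | e | e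
  · exact .inl ⟨hGL.1 X Y e, hn, H, hH, hHG, hbi⟩
  · exact .inr ⟨hGL.1 Y X e, fun h => hn (G.bi_symm Y X h), H, hH, hHG, H.bi_symm X Y hbi⟩
  · exact absurd (hGL.2 X Y e) hn

theorem IsCompatibleWith.exists_isInvisible_of_ne (hL : L.IsMAG) (hH : H.IsCompatibleWith L)
    (hHG : H.Contains G) (hGL : G.Contains L) (hne : G ≠ H) :
    ∃ X Y, IsInvisible L G X Y ∧ H.bi X Y := by
  by_contra! hnone
  refine hne (hHG.antisymm ⟨fun X Y e => hGL.1 X Y (hH.dir_eq hL ▸ e), fun X Y e => ?_⟩)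
  by_contra hn
  rcases hH.isInvisible_or_isInvisible hL.2 hHG hGL e hn with h | h
  · exact hnone X Y h e
  · exact hnone Y X h (H.bi_symm X Y e)

theorem IsCompatibleWith.isMBD_iff_not_hasInvisible (hL : L.IsMaximal)
    (hG : G.IsCompatibleWith L) (hGL : G.Contains L) : G.IsMBD ↔ ¬ HasInvisible L G := by
  constructor
  · rintro hmax ⟨X, Y, h⟩
    exact hmax X Y h.ne h.2.1
      ((h.addBi_isCompatibleWith hGL).markovEquiv.trans hG.markovEquiv.symm)
  · intro hn X Y hne hbi hequiv
    rcases (hG.addBi hequiv).isInvisible_or_isInvisible hL (addBi_contains G X Y) hGL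
      (addBi_bi_self hne) hbi with h | h
    · exact hn ⟨X, Y, h⟩
    · exact hn ⟨Y, X, h⟩

/-- A diagram compatible with `L` that contains `L` and has no invisible edges, which is what the
procedure looks for. -/
structure IsSaturated (L G : MixedGraph V) : Prop where
  isCompatibleWith : G.IsCompatibleWith L
  contains : G.Contains L
  not_hasInvisible : ¬ HasInvisible L G

theorem isSaturated_iff (hL : L.IsMAG) :
    IsSaturated L G ↔ G.IsCompatibleWith L ∧ G.IsMBD := by
  constructor
  · rintro ⟨hG, hGL, hn⟩
    exact ⟨hG, (hG.isMBD_iff_not_hasInvisible hL.2 hGL).2 hn⟩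
  · rintro ⟨hG, hmax⟩
    have hGL := hG.contains_of_isMBD hL.1 hmax
    exact ⟨hG, hGL, (hG.isMBD_iff_not_hasInvisible hL.2 hGL).1 hmax⟩

theorem IsSaturated.eq_of_contains (hL : L.IsMAG) (hK : IsSaturated L K) (hKG : K.Contains G)
    (hGL : G.Contains L) (hn : ¬ HasInvisible L G) : G = K := by
  by_contra hne
  obtain ⟨X, Y, h, -⟩ := hK.isCompatibleWith.exists_isInvisible_of_ne hL hKG hGL hne
  exact hn ⟨X, Y, h⟩

theorem IsSaturated.exists_contains_addBi (hL : L.IsMAG) (hK : IsSaturated L K)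
    (hKG : K.Contains G) (hGL : G.Contains L) (hG : HasInvisible L G) :
    ∃ X Y, IsInvisible L G X Y ∧ K.Contains (G.addBi X Y) := by
  have hne : G ≠ K := by
    rintro rfl
    exact hK.not_hasInvisible hG
  obtain ⟨X, Y, h, hbi⟩ := hK.isCompatibleWith.exists_isInvisible_of_ne hL hKG hGL hne
  exact ⟨X, Y, h, hKG.addBi hbi⟩

/-! ### The procedure -/

/-- The number of bi-directed edges, each of them counted twice, as ordered pairs. -/
noncomputable def biCount (G : MixedGraph V) : ℕ :=
  Set.ncard {e : V × V | G.bi e.1 e.2}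

theorem biCount_lt_biCount_addBi [Finite V] (hne : X ≠ Y) (h : ¬ G.bi X Y) :
    G.biCount < (G.addBi X Y).biCount := by
  refine Set.ncard_lt_ncard (Set.ssubset_iff_exists.2 ⟨fun _ he => .inl he, (X, Y), ?_, h⟩)
  exact addBi_bi_self hne

variable {s : List (MixedGraph V) × List (MixedGraph V)}

/-- The loop invariant of the procedure: no saturated diagram is lost, since each of them has been
returned already or can still be reached from a pending diagram. -/
structure Invariant (L : MixedGraph V) (s : List (MixedGraph V) × List (MixedGraph V)) :
    Prop where
  pending : ∀ G ∈ s.1, G.Contains L ∧ HasInvisible L G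
  returned : ∀ K ∈ s.2, IsSaturated L K
  complete : ∀ K, IsSaturated L K → K ∈ s.2 ∨ ∃ G ∈ s.1, K.Contains G

theorem Invariant.mem_snd_iff (h : Invariant L s) (hs : s.1 = []) :
    G ∈ s.2 ↔ IsSaturated L G :=
  ⟨h.returned G, fun hG => (h.complete G hG).resolve_right (by simp [hs])⟩

variable [Fintype V]

theorem mem_children : K ∈ children L G ↔ ∃ X Y, IsInvisible L G X Y ∧ G.addBi X Y = K := by
  simp [children, invisibleEdges]

theorem mem_pass_fst :
    K ∈ (pass L s).1 ↔ ∃ G ∈ s.1, K ∈ children L G ∧ HasInvisible L K := by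
  simp [pass, unfinished]

theorem mem_pass_snd :
    K ∈ (pass L s).2 ↔ K ∈ s.2 ∨ ∃ G ∈ s.1, K ∈ children L G ∧ ¬ HasInvisible L K := by
  simp [pass, finished]

theorem le_biCount_of_mem_iterate_pass (n : ℕ) (h : K ∈ ((pass L)^[n] s).1) : n ≤ K.biCount := by
  induction n generalizing K with
  | zero => exact Nat.zero_le _
  | succ n ih =>
    rw [Function.iterate_succ_apply'] at h
    obtain ⟨G, hG, hK, -⟩ := mem_pass_fst.1 h
    obtain ⟨X, Y, hXY, rfl⟩ := mem_children.1 hK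
    exact (ih hG).trans_lt (biCount_lt_biCount_addBi hXY.ne hXY.2.1)

theorem exists_iterate_pass_fst_eq_nil (L : MixedGraph V)
    (s : List (MixedGraph V) × List (MixedGraph V)) : ∃ n, ((pass L)^[n] s).1 = [] := by
  refine ⟨Nat.card (V × V) + 1, List.eq_nil_iff_forall_not_mem.2 fun K hK => ?_⟩
  exact (Set.ncard_le_card _).not_gt (le_biCount_of_mem_iterate_pass _ hK)

theorem Invariant.pass (hL : L.IsMAG) (h : Invariant L s) : Invariant L (pass L s) where
  pending K hK := by
    obtain ⟨G, hG, hK, hinv⟩ := mem_pass_fst.1 hK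
    obtain ⟨X, Y, -, rfl⟩ := mem_children.1 hK
    exact ⟨(addBi_contains G X Y).trans (h.pending G hG).1, hinv⟩
  returned K hK := by
    rcases mem_pass_snd.1 hK with hK | ⟨G, hG, hK, hn⟩
    · exact h.returned K hK
    · obtain ⟨X, Y, hXY, rfl⟩ := mem_children.1 hK
      have hGL := (h.pending G hG).1
      exact ⟨hXY.addBi_isCompatibleWith hGL, (addBi_contains G X Y).trans hGL, hn⟩
  complete K hK := by
    rcases h.complete K hK with hmem | ⟨G, hG, hKG⟩
    · exact .inl (mem_pass_snd.2 (.inl hmem))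
    obtain ⟨hGL, hinv⟩ := h.pending G hG
    obtain ⟨X, Y, hXY, hle⟩ := hK.exists_contains_addBi hL hKG hGL hinv
    have hchild : G.addBi X Y ∈ children L G := mem_children.2 ⟨X, Y, hXY, rfl⟩
    by_cases hinv' : HasInvisible L (G.addBi X Y)
    · exact .inr ⟨_, mem_pass_fst.2 ⟨G, hG, hchild, hinv'⟩, hle⟩
    · obtain rfl := hK.eq_of_contains hL hle ((addBi_contains G X Y).trans hGL) hinv'
      exact .inl (mem_pass_snd.2 (.inr ⟨G, hG, hchild, hinv'⟩))

theorem Invariant.iterate_pass (hL : L.IsMAG) (h : Invariant L s) (n : ℕ) :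
    Invariant L ((MixedGraph.pass L)^[n] s) :=
  Function.Iterate.rec (Invariant L) h (fun _ h => h.pass hL) n

theorem initialState_eq_pass (hL : L.IsMaximal) (h : HasInvisible L L) :
    initialState L = pass L ([L], []) := by
  have hall : initialDiagrams L = children L L := by
    rw [initialDiagrams, if_pos h, children, List.filter_eq_self.2]
    intro e he
    have he' : IsInvisible L L e.1 e.2 := by simpa [invisibleEdges] using he
    simpa using he'.parentsSpousesAdjacent hL
  simp [initialState, pass, hall]

theorem initialState_of_not_hasInvisible (h : ¬ HasInvisible L L) :
    initialState L = ([], [L]) := by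
  simp [initialState, initialDiagrams, unfinished, finished, h]

theorem invariant_initialState (hL : L.IsMAG) : Invariant L (initialState L) := by
  by_cases h : HasInvisible L L
  · have hstart : Invariant L ([L], []) :=
      ⟨by simpa using ⟨.refl L, h⟩, by simp, fun K hK => .inr ⟨L, by simp, hK.contains⟩⟩
    rw [initialState_eq_pass hL.2 h]
    exact hstart.pass hL
  · rw [initialState_of_not_hasInvisible h]
    refine ⟨by simp, ?_, fun K hK => .inl ?_⟩
    · simpa using ⟨hL.1.1.isCompatibleWith_self, .refl L, h⟩
    · rw [hK.eq_of_contains hL hK.contains (.refl L) h]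
      exact List.mem_singleton_self K

end MixedGraph

theorem mainTheorem10_general {V : Type*} [Fintype V] (L : MixedGraph V) (hL : L.IsMAG) :
    ∃ out : List (MixedGraph V), MixedGraph.Returns L out ∧
      ∀ G : MixedGraph V, G ∈ out ↔ (G.IsCompatibleWith L ∧ G.IsMBD) := by
  obtain ⟨n, hn⟩ := MixedGraph.exists_iterate_pass_fst_eq_nil L (MixedGraph.initialState L)
  have hinv := (MixedGraph.invariant_initialState hL).iterate_pass hL n
  refine ⟨_, ⟨n, Prod.ext hn rfl⟩, fun G => ?_⟩
  rw [← MixedGraph.isSaturated_iff hL]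
  exact hinv.mem_snd_iff hn

theorem mainTheorem10 {V : Type*} [Fintype V] (L : MixedGraph V) (hL : L.IsLEG) :
    ∃ out : List (MixedGraph V), MixedGraph.Returns L out ∧
      ∀ G : MixedGraph V, G ∈ out ↔ (G.IsCompatibleWith L ∧ G.IsMBD) := by
  obtain ⟨_, _, hMAG, _⟩ := hL
  exact mainTheorem10_general L hMAG
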